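/- Let $d,c\ge 1$ and $r_{\mathcal F},r_{\mathcal B},c_{\mathcal F},c_{\mathcal B}\ge 0$ be integers, let $\Omega\subset\mathbb R^d$ be open (for instance a bounded Lipschitz domain) and $\Gamma\subseteq\partial\Omega$. Let $X:=C^{r_{\mathcal F}}(\Omega,\mathbb R^c)\cap C^{r_{\mathcal B}}(\overline\Omega,\mathbb R^c)$ be the set of functions $u:\overline\Omega\to\mathbb R^c$ that are continuous on $\overline\Omega$, of class $C^{r_{\mathcal F}}$ and $C^{r_{\mathcal B}}$ in $\Omega$, and whose derivatives $D^\beta u$, $|\beta|\le r_{\mathcal B}$, extend continuously from $\Omega$ to $\overline\Omega$; for $z\in\partial\Omega$, $D^\beta u(z)$ denotes the value of this extension at $z$. Let $\Omega^h\subset\Omega$ and $\Gamma^h\subset\Gamma$ be finite sets of $N_{\mathcal F}\ge 1$ and $N_{\mathcal B}\ge 1$ points, respectively, and let $\mathcal D^h\subseteq\Omega^h\cup\Gamma^h$. Let $F$ and $B$ be arbitrary functions with values in $\mathbb R^{c_{\mathcal F}}$ and $\mathbb R^{c_{\mathcal B}}$, let $u^*:\mathcal D^h\to\mathbb R^c$,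 let $\alpha_{\mathcal F},\alpha_{\mathcal B},\alpha_{\mathcal D}$ and $\omega_{\mathcal F}^z,\omega_{\mathcal B}^z,\omega_{\mathcal D}^z$ be real numbers, let $\nu\in[1,\infty)$, and write $|v|_\nu^\nu=\sum_i|v_i|^\nu$. The AD-PINN loss is $$\mathcal J^h(u)=\alpha_{\mathcal F}\sum_{z\in\Omega^h}\omega_{\mathcal F}^z\bigl|F\bigl(z,\{D^\beta u(z)\}_{|\beta|\le r_{\mathcal F}}\bigr)\bigr|_\nu^\nu+\alpha_{\mathcal B}\sum_{z\in\Gamma^h}\omega_{\mathcal B}^z\bigl|B\bigl(z,\{D^\beta u(z)\}_{|\beta|\le r_{\mathcal B}}\bigr)\bigr|_\nu^\nu+\alpha_{\mathcal D}\sum_{z\in\mathcal D^h}\omega_{\mathcal D}^z|u(z)-u^*(z)|_\nu^\nu .$$ Set $\ell:=N_{\mathcal F}(d+r_{\mathcal F})+N_{\mathcal B}(d+r_{\mathcal B})$ and let $\sigma\in C^{\ell-d}(\mathbb R,\mathbb R)$ be such that, for some $a\in\mathbb R$, $\sigma^{(k)}(a)\ne 0$ for all $0\le k\le\ell-d$.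 Let $\mathcal H^M$ be the set of restrictions to $\overline\Omega$ of all depth-2 networks $x\mapsto W_2\,\sigma(W_1x+b_1)+b_2$ from $\mathbb R^d$ to $\mathbb R^c$ with $n=c\binom{\ell}{d}$ hidden units, where $\sigma$ acts componentwise and $W_1\in\mathbb R^{n\times d}$, $b_1\in\mathbb R^n$, $W_2\in\mathbb R^{c\times n}$, $b_2\in\mathbb R^c$ are arbitrary. Let $U\subseteq X$ be a set that contains every function of $\mathcal H^M$ lying in $X$ (for instance $U=X$). Then, minimizers being global minimizers: (i) if $\hat u$ minimizes $\mathcal J^h$ over $U$, then there is $u_\theta\in\mathcal H^M$ that minimizes $\mathcal J^h$ over $\mathcal H^M$ and satisfies $\mathcal J^h(u_\theta)=\mathcal J^h(\hat u)$ and $u_\theta(z)=\hat u(z)$ for all $z\in\Omega^h\cup\Gamma^h$; (ii) if $\hat u_\theta$ minimizes $\mathcal J^h$ over $\mathcal H^M$, then $\hat u_\theta\in U$ and $\hat u_\theta$ minimizes $\mathcal J^h$ over $U$. -/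

import Mathlib

open Set Filter Topology
open scoped Matrix

noncomputable section

namespace PINN

/-- The coordinate space `ℝᵈ`. Only its topology and its differential calculus are used, and these
do not depend on the choice of the norm. -/
abbrev Vec (d : ℕ) : Type := Fin d → ℝ

/-- Functions `Ω̄ → ℝᶜ`. -/
abbrev Fld {d : ℕ} (Ω : Set (Vec d)) (c : ℕ) : Type := closure Ω → Vec c

open Classical in
/-- Extension by zero of a function on `Ω̄` to all of `ℝᵈ`. It is only evaluated at points of `Ω̄`,
and only differentiated at points of the open set `Ω`, so the values off `Ω̄` are irrelevant. -/
def ext {d c : ℕ} {Ω : Set (Vec d)} (u : Fld Ω c) : Vec d → Vec c :=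
  fun x => if h : x ∈ closure Ω then u ⟨x, h⟩ else 0

/-- The partial derivative `∂ᵢ f`. -/
def pderiv {d c : ℕ} (i : Fin d) (f : Vec d → Vec c) : Vec d → Vec c :=
  fun x => lineDeriv ℝ f x (Pi.single i 1)

/-- The multi-index derivative `D^β f = ∂₁^{β₁} ⋯ ∂_d^{β_d} f`. -/
def multiDeriv {d c : ℕ} (β : Fin d → ℕ) (f : Vec d → Vec c) : Vec d → Vec c :=
  (List.finRange d).foldr (fun i g => (pderiv i)^[β i] g) f

/-- Multi-indices `β` with `|β| ≤ r`. -/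
abbrev MultiIndex (d r : ℕ) : Type := {β : Fin d → ℕ // ∑ i, β i ≤ r}

/-- Values for the collection `{D^β u(z) : |β| ≤ r}`. -/
abbrev Jet (d c r : ℕ) : Type := MultiIndex d r → Vec c

/-- `u ∈ Cʳ(Ω, ℝᶜ)`. -/
def IsCkOpen {d c : ℕ} {Ω : Set (Vec d)} (r : ℕ) (u : Fld Ω c) : Prop :=
  ContDiffOn ℝ r (ext u) Ω

/-- `u ∈ Cʳ(Ω̄, ℝᶜ)`: `u` is continuous on `Ω̄`, of class `Cʳ` in `Ω`, and every derivative
`D^β u`, `|β| ≤ r`, extends continuously from `Ω` to `Ω̄`. -/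
def IsCkClosure {d c : ℕ} {Ω : Set (Vec d)} (r : ℕ) (u : Fld Ω c) : Prop :=
  Continuous u ∧ ContDiffOn ℝ r (ext u) Ω ∧
    ∀ β : MultiIndex d r, ∃ g : Fld Ω c, Continuous g ∧
      ∀ (z : Vec d) (hz : z ∈ Ω), g ⟨z, subset_closure hz⟩ = multiDeriv β.1 (ext u) z

/-- The space `C^{r_F}(Ω, ℝᶜ) ∩ C^{r_B}(Ω̄, ℝᶜ)`. -/
def strongSpace {d : ℕ} (Ω : Set (Vec d)) (c rF rB : ℕ) : Set (Fld Ω c) :=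
  {u | IsCkOpen rF u ∧ IsCkClosure rB u}

/-- The classical derivatives `{D^β u(z) : |β| ≤ r}` at an interior point `z ∈ Ω`. -/
def interiorJet {d c : ℕ} {Ω : Set (Vec d)} (r : ℕ) (u : Fld Ω c) (z : Vec d) : Jet d c r :=
  fun β => multiDeriv β.1 (ext u) z

/-- The derivatives `{D^β u(z) : |β| ≤ r}` at a boundary point `z ∈ ∂Ω`: the boundary value at `z`
of `D^β u`, i.e. its limit at `z` from within `Ω`. -/
def boundaryJet {d c : ℕ} {Ω : Set (Vec d)} (r : ℕ) (u : Fld Ω c) (z : Vec d) : Jet d c r :=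
  fun β => limUnder (𝓝[Ω] z) (multiDeriv β.1 (ext u))

/-- `|v|_ν^ν = ∑ᵢ |vᵢ|^ν`. -/
def lpPow {m : ℕ} (ν : ℝ) (v : Vec m) : ℝ := ∑ i, |v i| ^ ν

/-- The data of an AD-PINN problem on `Ω ⊆ ℝᵈ` with boundary part `Γ`, for an unknown with values in
`ℝᶜ`, an interior operator of order `rF` with values in `ℝ^{cF}` and a boundary operator of order
`rB` with values in `ℝ^{cB}`. -/
structure Problem {d : ℕ} (Ω Γ : Set (Vec d)) (c cF cB rF rB : ℕ) where
  /-- The function `F` with `𝓕(u)(z) = F(z, {D^β u(z) : |β| ≤ rF})`. -/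
  F : Vec d → Jet d c rF → Vec cF
  /-- The function `B` with `𝓑(u)(z) = B(z, {D^β u(z) : |β| ≤ rB})`. -/
  B : Vec d → Jet d c rB → Vec cB
  /-- Interior collocation points. -/
  Ωh : Finset (Vec d)
  /-- Boundary collocation points. -/
  Γh : Finset (Vec d)
  /-- Locations of the observation data. -/
  Dh : Finset (Vec d)
  Ωh_sub : (Ωh : Set (Vec d)) ⊆ Ω
  Γh_sub : (Γh : Set (Vec d)) ⊆ Γ
  Dh_sub : (Dh : Set (Vec d)) ⊆ (Ωh : Set (Vec d)) ∪ (Γh : Set (Vec d))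
  /-- The observation data `u*`. -/
  uStar : Vec d → Vec c
  /-- Quadrature weights of the three terms. -/
  ωF : Vec d → ℝ
  ωB : Vec d → ℝ
  ωD : Vec d → ℝ
  /-- Coefficients of the three terms. -/
  αF : ℝ
  αB : ℝ
  αD : ℝ
  /-- The exponent of the discrete norms. -/
  ν : ℝ
  one_le_ν : 1 ≤ ν

/-- The AD-PINN functional `J^h`. -/
def Problem.loss {d : ℕ} {Ω Γ : Set (Vec d)} {c cF cB rF rB : ℕ}
    (P : Problem Ω Γ c cF cB rF rB) (u : Fld Ω c) : ℝ :=
  P.αF * ∑ z ∈ P.Ωh, P.ωF z * lpPow P.ν (P.F z (interiorJet rF u z))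
    + P.αB * ∑ z ∈ P.Γh, P.ωB z * lpPow P.ν (P.B z (boundaryJet rB u z))
    + P.αD * ∑ z ∈ P.Dh, P.ωD z * lpPow P.ν (ext u z - P.uStar z)

/-- `u ∈ argmin_{v ∈ S} J(v)` (global minimizers). -/
def IsMinimizer {α : Type*} (J : α → ℝ) (S : Set α) (u : α) : Prop :=
  u ∈ S ∧ IsMinOn J S u

/-- Weights and biases of a fully connected depth-2 network `ℝᵈ → ℝᶜ` with `n` hidden units. These
are `n * (d + 1) + c * (n + 1)` real parameters. -/
structure ShallowNet (d n c : ℕ) where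
  W₁ : Matrix (Fin n) (Fin d) ℝ
  b₁ : Fin n → ℝ
  W₂ : Matrix (Fin c) (Fin n) ℝ
  b₂ : Fin c → ℝ

/-- The realization `x ↦ W₂ σ(W₁ x + b₁) + b₂`, with `σ` acting componentwise. -/
def ShallowNet.eval {d n c : ℕ} (θ : ShallowNet d n c) (σ : ℝ → ℝ) (x : Vec d) : Vec c :=
  θ.W₂ *ᵥ (fun j => σ ((θ.W₁ *ᵥ x + θ.b₁) j)) + θ.b₂

/-- The class of restrictions to `Ω̄` of depth-2 networks `ℝᵈ → ℝᶜ` with activation `σ` and `n`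
hidden units. -/
def netClass {d : ℕ} (Ω : Set (Vec d)) (c n : ℕ) (σ : ℝ → ℝ) : Set (Fld Ω c) :=
  {u | ∃ θ : ShallowNet d n c, ∀ x : closure Ω, u x = θ.eval σ x}

end PINN

end

/-! The loss sees `u` only through finitely many numbers: its jets at the collocation points, which
include the values at the data points. If networks realize every such jet, `H ⊆ U` makes the loss
take the same values on `H` as on `U`, and both claims follow.

Realizing jets is Hermite interpolation by ridge functions `σ(w·x + b)` (`span_ridgeJet`). Let a
linear functional with coefficients `c_{i,β}` kill all ridge jets and put `K = ℓ - d`. Replacing `w`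
by `t w`, taking `b = a` and expanding at `t = 0` up to order `K`, the nonvanishing of `σ⁽ᵏ⁾(a)`
shows that it kills `p(w·x)` for every univariate `p` of degree at most `K`. If `w` separates the
points, this is a relation between derivatives of `p` at distinct nodes `w·zᵢ`, with at most `K + 1`
conditions, hence trivial (`hermite_coeff_eq_zero`). So each `∑_β c_{i,β} w^β` vanishes for generic
`w`, hence identically (`mvPolynomial_eq_zero_of_generic`), and `c = 0`. A basis of the jet space
needs at most `ℓ.choose d` hidden units. -/

namespace PINN

/-! ### Counting multi-indices -/

/-- The number of multi-indices of length at most `r`. -/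
lemma card_multiIndex_le (d r : ℕ) : Nat.card (MultiIndex d r) ≤ (d + r).choose d := by
  classical
  -- The slack coordinate `r - |β|` turns `|β| ≤ r` into an equality in `d + 1` variables.
  let f : MultiIndex d r → ((Finset.univ : Finset (Fin (d + 1))).finsuppAntidiag r) := fun β =>
    ⟨Finsupp.equivFunOnFinite.symm (Fin.cons (r - ∑ i, β.1 i) β.1), by
      have := β.2
      simp [Finset.mem_finsuppAntidiag, Fin.sum_univ_succ]
      omega⟩
  have hf : Function.Injective f := by
    intro β γ h
    have h1 := congrArg Subtype.val h
    have h2 := Finsupp.equivFunOnFinite.symm.injective h1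
    exact Subtype.ext (Fin.cons_injective2 h2).2
  have h := Nat.card_le_card_of_injective f hf
  rw [Nat.card_eq_finsetCard, Finset.card_finsuppAntidiag_nat_eq_choose] at h
  simp only [Finset.card_univ, Fintype.card_fin] at h
  rw [show d + 1 + r - 1 = d + r by omega, ← Nat.choose_symm_add] at h
  exact h

instance (d r : ℕ) : Finite (MultiIndex d r) := by
  have : Function.Injective (fun (β : MultiIndex d r) (i : Fin d) =>
      (⟨β.1 i, Nat.lt_succ_of_le ((Finset.single_le_sum (fun _ _ => Nat.zero_le _)
        (Finset.mem_univ i)).trans β.2)⟩ : Fin (r + 1))) := by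
    intro β γ h
    ext i
    simpa using congrFun h i
  exact Finite.of_injective _ this

/-- Two terms of Vandermonde's identity, distinct because `d ≥ 1`. -/
lemma choose_add_choose_le {d : ℕ} (hd : 1 ≤ d) (m n : ℕ) :
    m.choose d + n.choose d ≤ (m + n).choose d := by
  rw [Nat.add_choose_eq]
  have hne : ((d, 0) : ℕ × ℕ) ≠ (0, d) := by simp; omega
  calc m.choose d + n.choose d
      = ∑ ij ∈ {((d, 0) : ℕ × ℕ), (0, d)}, m.choose ij.1 * n.choose ij.2 := by
        rw [Finset.sum_pair hne]; simp
    _ ≤ _ := Finset.sum_le_sum_of_subset (by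
        intro x hx
        simp only [Finset.mem_insert, Finset.mem_singleton] at hx
        rcases hx with rfl | rfl <;> simp)

lemma mul_choose_le {d : ℕ} (hd : 1 ≤ d) (N m : ℕ) : N * m.choose d ≤ (N * m).choose d := by
  induction N with
  | zero => simp
  | succ N ih =>
    calc (N + 1) * m.choose d = N * m.choose d + m.choose d := by ring
      _ ≤ (N * m).choose d + m.choose d := by gcongr
      _ ≤ (N * m + m).choose d := choose_add_choose_le hd _ _
      _ = _ := by congr 1; ring

/-! ### From the activation to polynomials -/

lemma coeff_eq_zero_of_isLittleO {K : ℕ} {C : ℕ → ℝ}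
    (h : (fun t : ℝ => ∑ k ∈ Finset.range (K + 1), C k * t ^ k) =o[𝓝[≠] 0] fun t => t ^ K) :
    ∀ k ≤ K, C k = 0 := by
  induction K generalizing C with
  | zero =>
    intro k hk
    obtain rfl : k = 0 := by omega
    simpa [Asymptotics.isLittleO_const_const_iff] using h
  | succ K ih =>
    have h0 : C 0 = 0 := by
      have h1 : Tendsto (fun t : ℝ => ∑ k ∈ Finset.range (K + 1 + 1), C k * t ^ k)
          (𝓝[≠] 0) (𝓝 (∑ k ∈ Finset.range (K + 1 + 1), C k * 0 ^ k)) := by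
        apply Tendsto.mono_left _ nhdsWithin_le_nhds
        exact Continuous.tendsto (by fun_prop) _
      have h2 : Tendsto (fun t : ℝ => t ^ (K + 1)) (𝓝[≠] 0) (𝓝 (0 ^ (K + 1))) :=
        Tendsto.mono_left (Continuous.tendsto (by fun_prop) _) nhdsWithin_le_nhds
      have h3 := tendsto_nhds_unique h1 (h.trans_tendsto (by simpa using h2))
      simpa [Finset.sum_range_succ'] using h3
    have h' : (fun t : ℝ => ∑ k ∈ Finset.range (K + 1), C (k + 1) * t ^ k)
        =o[𝓝[≠] 0] fun t => t ^ K := by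
      have h4 := (Asymptotics.isBigO_refl (fun t : ℝ => t⁻¹) (𝓝[≠] 0)).mul_isLittleO h
      refine h4.congr' ?_ ?_
      · filter_upwards [self_mem_nhdsWithin] with t ht
        rw [Finset.sum_range_succ', h0, zero_mul, add_zero, Finset.mul_sum]
        refine Finset.sum_congr rfl fun k _ => ?_
        have : t ≠ 0 := ht
        field_simp
        ring
      · filter_upwards [self_mem_nhdsWithin] with t ht
        have : t ≠ 0 := ht
        field_simp
        ring
    intro k hk
    cases k with
    | zero => exact h0
    | succ k => exact ih h' k (by omega)

lemma iteratedDeriv_iteratedDeriv (m n : ℕ) (σ : ℝ → ℝ) :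
    iteratedDeriv m (iteratedDeriv n σ) = iteratedDeriv (m + n) σ := by
  simp only [iteratedDeriv_eq_iterate, Function.iterate_add_apply]

lemma contDiff_iteratedDeriv {m n K : ℕ} (h : n + m ≤ K) {σ : ℝ → ℝ} (hσ : ContDiff ℝ K σ) :
    ContDiff ℝ n (iteratedDeriv m σ) := by
  rw [iteratedDeriv_eq_iterate]
  exact ContDiff.iterate_deriv' n m (hσ.of_le (by exact_mod_cast h))

open scoped Nat in
/-- Taylor expansion in `t` of `t ^ m * σ⁽ᵐ⁾ (t * s + a)`, the `m`-th derivative in `s` of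
`σ (t * s + a)`. -/
lemma pow_mul_iteratedDeriv_isLittleO {K m : ℕ} (hm : m ≤ K) {σ : ℝ → ℝ}
    (hσ : ContDiff ℝ K σ) (a s : ℝ) :
    (fun t : ℝ => t ^ m * iteratedDeriv m σ (t * s + a) - ∑ k ∈ Finset.range (K + 1),
      (m ! * (s ^ (k - m) * k.choose m) * (iteratedDeriv k σ a / k !)) * t ^ k)
      =o[𝓝 0] fun t => t ^ K := by
  obtain ⟨n, rfl⟩ := Nat.exists_eq_add_of_le hm
  have h1 := taylor_isLittleO_univ (x₀ := a)
    (contDiff_iteratedDeriv (m := m) (n := n) (by omega) hσ)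
  have ht : Tendsto (fun t : ℝ => t * s + a) (𝓝 0) (𝓝 a) := by
    have : Continuous fun t : ℝ => t * s + a := by fun_prop
    simpa using this.tendsto 0
  have h2 := h1.comp_tendsto ht
  have h3 : ((fun t : ℝ => (t - a) ^ n) ∘ fun t : ℝ => t * s + a) =O[𝓝 0] fun t : ℝ => t ^ n := by
    have : ((fun t : ℝ => (t - a) ^ n) ∘ fun t : ℝ => t * s + a)
        = fun t : ℝ => s ^ n * t ^ n := by
      ext t; simp [mul_pow, mul_comm]
    rw [this]
    exact (Asymptotics.isBigO_refl _ _).const_mul_left _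
  have h4 := (Asymptotics.isBigO_refl (fun t : ℝ => t ^ m) (𝓝 0)).mul_isLittleO
    (h2.trans_isBigO h3)
  refine h4.congr ?_ fun t => (pow_add t m n).symm
  intro t
  simp only [Function.comp, taylor_within_apply, iteratedDerivWithin_univ,
    iteratedDeriv_iteratedDeriv, mul_sub]
  congr 1
  -- The terms with `k < m` vanish through `k.choose m = 0`, so the truncated `k - m` does no harm
  -- there.
  rw [add_assoc, Finset.sum_range_add (n := m), Finset.sum_eq_zero (s := Finset.range m), zero_add,
    Finset.mul_sum]
  · refine Finset.sum_congr rfl fun k _ => ?_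
    rw [Nat.choose_symm_add, Nat.add_choose, Nat.cast_div (Nat.factorial_mul_factorial_dvd_factorial_add m k)
      (by positivity)]
    push_cast
    have := Nat.factorial_ne_zero m
    have := Nat.factorial_ne_zero k
    have := Nat.factorial_ne_zero (m + k)
    rw [Nat.add_sub_cancel_left, smul_eq_mul, add_comm k m, add_sub_cancel_right]
    field_simp
    ring
  · intro k hk
    rw [Nat.choose_eq_zero_of_lt (Finset.mem_range.1 hk)]
    simp

-- Here `m! * (taylor s p).coeff m` is `p⁽ᵐ⁾(s)`. The `t ^ k` coefficient of the relation `h` is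
-- `σ⁽ᵏ⁾(a) / k!` times the functional at `X ^ k`; the first factor is nonzero, and linearity gives
-- all `p`.
open scoped Nat in
open Polynomial in
lemma sum_factorial_mul_taylor_coeff_eq_zero {ι : Type*} [Fintype ι] {K : ℕ} {σ : ℝ → ℝ}
    (hσ : ContDiff ℝ K σ) {a : ℝ} (ha : ∀ k ≤ K, iteratedDeriv k σ a ≠ 0)
    {q : ι → ℝ} {m : ι → ℕ} {s : ι → ℝ} (hm : ∀ i, m i ≤ K)
    (h : ∀ t : ℝ, ∑ i, q i * (t ^ m i * iteratedDeriv (m i) σ (t * s i + a)) = 0)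
    {p : ℝ[X]} (hp : p.natDegree ≤ K) :
    ∑ i, q i * ((m i)! * (taylor (s i) p).coeff (m i)) = 0 := by
  have hX : ∀ k ≤ K, ∑ i, q i * ((m i)! * (taylor (s i) (X ^ k : ℝ[X])).coeff (m i)) = 0 := by
    have h1 := Asymptotics.IsLittleO.fun_sum (s := Finset.univ) fun i (_ : i ∈ Finset.univ) =>
      (pow_mul_iteratedDeriv_isLittleO (hm i) hσ a (s i)).const_mul_left (q i)
    have h2 := (h1.mono (nhdsWithin_le_nhds (s := {0}ᶜ))).neg_left.congr_left
      (f₂ := fun t : ℝ => ∑ k ∈ Finset.range (K + 1), ((∑ i, q i * ((m i)! *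
        (taylor (s i) (X ^ k : ℝ[X])).coeff (m i))) * (iteratedDeriv k σ a / k !)) * t ^ k) (by
        intro t
        simp only [mul_sub, Finset.sum_sub_distrib, h t, zero_sub, neg_neg, Finset.mul_sum,
          Finset.sum_mul]
        rw [Finset.sum_comm]
        refine Finset.sum_congr rfl fun k _ => Finset.sum_congr rfl fun i _ => ?_
        rw [taylor_X_pow, coeff_X_add_C_pow]
        ring)
    intro k hk
    have h3 := coeff_eq_zero_of_isLittleO h2 k hk
    have h4 : iteratedDeriv k σ a / (k ! : ℝ) ≠ 0 :=
      div_ne_zero (ha k hk) (by exact_mod_cast Nat.factorial_ne_zero k)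
    exact (mul_eq_zero.1 h3).resolve_right h4
  rw [p.as_sum_range' (K + 1) (by omega)]
  simp only [map_sum, finsetSum_coeff, Finset.mul_sum]
  rw [Finset.sum_comm]
  refine Finset.sum_eq_zero fun k hk => ?_
  have h5 := congrArg (p.coeff k * ·) (hX k (by simpa [Nat.lt_succ_iff] using hk))
  simp only [mul_zero, Finset.mul_sum] at h5
  rw [← h5]
  refine Finset.sum_congr rfl fun i _ => ?_
  rw [← C_mul_X_pow_eq_monomial, ← smul_eq_C_mul, map_smul, coeff_smul, smul_eq_mul]
  ring

/-! ### Univariate Hermite functionals and generic directions -/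

open scoped Nat in
open Polynomial in
/-- Linear independence of the functionals `p ↦ p⁽ᵐ⁾(sᵢ)`, `m ≤ rᵢ`, on the polynomials of degree
less than their number. -/
lemma hermite_coeff_eq_zero {ι : Type*} [Fintype ι] {K : ℕ} {s : ι → ℝ}
    (hs : Function.Injective s) {r : ι → ℕ} (hr : ∑ i, (r i + 1) ≤ K + 1) {Q : ι → ℕ → ℝ}
    (h : ∀ p : ℝ[X], p.natDegree ≤ K → ∑ i, ∑ m ∈ Finset.range (r i + 1),
      Q i m * (m ! * (taylor (s i) p).coeff m) = 0) (i : ι) :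
    ∀ m ≤ r i, Q i m = 0 := by
  classical
  suffices H : ∀ n m, m + n = r i → Q i m = 0 from fun m hm => H (r i - m) m (by omega)
  intro n
  induction n using Nat.strong_induction_on with
  | _ n ih =>
  intro m hmn
  -- Descending induction on the order `m`. The test polynomial `(X - sᵢ)ᵐ g` kills all conditions
  -- at the other nodes and the orders below `m` at `sᵢ`; the orders above `m` have zero coefficient
  -- by induction.
  set g : ℝ[X] := ∏ j ∈ Finset.univ.erase i, (X - C (s j)) ^ (r j + 1) with hg
  have hdeg : ((X - C (s i)) ^ m * g).natDegree ≤ K := by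
    refine natDegree_mul_le.trans ?_
    have h1 : g.natDegree ≤ ∑ j ∈ Finset.univ.erase i, (r j + 1) := by
      refine (natDegree_prod_le _ _).trans (Finset.sum_le_sum fun j _ => ?_)
      simp
    have h2 := Finset.add_sum_erase Finset.univ (fun j => r j + 1) (Finset.mem_univ i)
    simp only [natDegree_pow, natDegree_X_sub_C, mul_one]
    omega
  have hT : ∀ (t : ℝ) (k : ℕ), taylor t ((X - C t) ^ k) = X ^ k := by
    intro t k
    simp [taylor_pow]
  have key := h _ hdeg
  rw [Finset.sum_eq_single i, Finset.sum_eq_single m] at key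
  · rw [taylor_mul, hT, coeff_X_pow_mul', if_pos le_rfl, Nat.sub_self, taylor_coeff_zero] at key
    have hne : g.eval (s i) ≠ 0 := by
      rw [hg, eval_prod, Finset.prod_ne_zero_iff]
      intro j hj
      simp only [eval_pow, eval_sub, eval_X, eval_C]
      exact pow_ne_zero _ (sub_ne_zero.2 fun e => (Finset.ne_of_mem_erase hj) (hs e).symm)
    have hf : (m ! : ℝ) ≠ 0 := by exact_mod_cast Nat.factorial_ne_zero m
    simpa [hne, hf] using key
  · intro k hk hkm
    rw [Finset.mem_range] at hk
    rcases lt_or_gt_of_ne hkm with hlt | hgt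
    · rw [taylor_mul, hT, coeff_X_pow_mul', if_neg (by omega)]
      simp
    · rw [ih (r i - k) (by omega) k (by omega), zero_mul]
  · intro hk
    exact absurd (Finset.mem_range.2 (by omega)) hk
  · intro j _ hj
    refine Finset.sum_eq_zero fun k hk => ?_
    rw [Finset.mem_range] at hk
    rw [hg, ← Finset.mul_prod_erase _ _ (Finset.mem_erase.2 ⟨hj, Finset.mem_univ j⟩),
      mul_left_comm ((X - C (s i)) ^ m), taylor_mul, hT, coeff_X_pow_mul', if_neg (by omega)]
    simp
  · intro hi
    exact absurd (Finset.mem_univ i) hi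

/-- A polynomial that vanishes at every direction separating finitely many given points is zero. -/
lemma mvPolynomial_eq_zero_of_generic {d : ℕ} {ι : Type*} [Fintype ι] {z : ι → Vec d}
    (hz : Function.Injective z) {p : MvPolynomial (Fin d) ℝ}
    (h : ∀ w : Vec d, Function.Injective (fun i => w ⬝ᵥ z i) → MvPolynomial.eval w p = 0) :
    p = 0 := by
  classical
  let lin : ι × ι → MvPolynomial (Fin d) ℝ := fun e =>
    ∑ l, MvPolynomial.C (z e.1 l - z e.2 l) * MvPolynomial.X l
  have hlin : ∀ e w, MvPolynomial.eval w (lin e) = w ⬝ᵥ z e.1 - w ⬝ᵥ z e.2 := by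
    intro e w
    simp only [lin, map_sum, map_mul, MvPolynomial.eval_C, MvPolynomial.eval_X, dotProduct,
      ← Finset.sum_sub_distrib]
    exact Finset.sum_congr rfl fun l _ => by ring
  -- The product of the forms `w·(zᵢ - zⱼ)` vanishes exactly where `w` fails to separate the points,
  -- so its product with `p` vanishes everywhere.
  have hne : ∏ e ∈ Finset.univ.filter (fun e : ι × ι => e.1 ≠ e.2), lin e ≠ 0 := by
    rw [Finset.prod_ne_zero_iff]
    intro e he h0
    apply (Finset.mem_filter.1 he).2
    apply hz
    ext l
    have h1 := hlin e (Pi.single l 1)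
    rw [h0] at h1
    simp only [map_zero, single_one_dotProduct] at h1
    linarith
  refine (mul_eq_zero.1 (?_ : (∏ e ∈ Finset.univ.filter (fun e : ι × ι => e.1 ≠ e.2), lin e) * p
    = 0)).resolve_left hne
  apply MvPolynomial.funext
  intro w
  rw [map_mul, map_prod, map_zero]
  by_cases hw : Function.Injective (fun i => w ⬝ᵥ z i)
  · rw [h w hw, mul_zero]
  · rw [Function.Injective] at hw
    push Not at hw
    obtain ⟨i, j, hij, hne'⟩ := hw
    rw [Finset.prod_eq_zero (i := (i, j)) (by simp [hne']), zero_mul]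
    rw [hlin, hij, sub_self]

/-! ### Jets of ridge functions span -/

/-- The derivatives of order at most `r i` at `z i` of the ridge function `x ↦ σ (w ⬝ᵥ x + b)`. -/
noncomputable def ridgeJet {d : ℕ} {ι : Type*} (σ : ℝ → ℝ) (z : ι → Vec d) (r : ι → ℕ) (w : Vec d) (b : ℝ) :
    (Σ i, MultiIndex d (r i)) → ℝ :=
  fun e => (∏ k, w k ^ e.2.1 k) * iteratedDeriv (∑ k, e.2.1 k) σ (w ⬝ᵥ z e.1 + b)

open scoped Nat in
lemma span_ridgeJet {d : ℕ} {ι : Type*} [Fintype ι] {K : ℕ} {σ : ℝ → ℝ}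
    (hσ : ContDiff ℝ K σ) {a : ℝ} (ha : ∀ k ≤ K, iteratedDeriv k σ a ≠ 0)
    {z : ι → Vec d} (hz : Function.Injective z) {r : ι → ℕ} (hr : ∑ i, (r i + 1) ≤ K + 1) :
    Submodule.span ℝ (range fun e : Vec d × ℝ => ridgeJet σ z r e.1 e.2) = ⊤ := by
  classical
  have := fun i => Fintype.ofFinite (MultiIndex d (r i))
  by_contra hne
  obtain ⟨f, hf0, hf⟩ := Submodule.exists_le_ker_of_lt_top _ (lt_top_iff_ne_top.2 hne)
  apply hf0
  set c : (Σ i, MultiIndex d (r i)) → ℝ := fun e => f (fun j => if e = j then 1 else 0)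
  have hfc : ∀ v, f v = ∑ e, v e * c e := fun v => LinearMap.pi_apply_eq_sum_univ f v
  suffices hc0 : ∀ e, c e = 0 by
    exact LinearMap.ext fun v => by simp [hfc, hc0]
  have hle : ∀ i, r i ≤ K := by
    intro i
    have := Finset.single_le_sum (f := fun i => r i + 1) (fun _ _ => Nat.zero_le _)
      (Finset.mem_univ i)
    omega
  -- Generating polynomial of the coefficients at the `i`-th point; its homogeneous parts evaluated
  -- at `w` are the univariate coefficients `Q i m`.
  let p : ι → MvPolynomial (Fin d) ℝ := fun i => ∑ β : MultiIndex d (r i),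
    MvPolynomial.monomial (Finsupp.equivFunOnFinite.symm β.1) (c ⟨i, β⟩)
  have hp : ∀ i, p i = 0 := by
    intro i
    refine mvPolynomial_eq_zero_of_generic hz fun w hw => ?_
    let q : (Σ i, MultiIndex d (r i)) → ℝ := fun e => (∏ k, w k ^ e.2.1 k) * c e
    let Q : ι → ℕ → ℝ := fun i m =>
      ∑ β : MultiIndex d (r i) with ∑ k, β.1 k = m, q ⟨i, β⟩
    have hkill : ∀ t : ℝ, ∑ e : Σ i, MultiIndex d (r i), q e * (t ^ (∑ k, e.2.1 k) *
        iteratedDeriv (∑ k, e.2.1 k) σ (t * (w ⬝ᵥ z e.1) + a)) = 0 := by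
      intro t
      have h1 : f (ridgeJet σ z r (t • w) a) = 0 :=
        hf (Submodule.subset_span ⟨(t • w, a), rfl⟩)
      rw [hfc] at h1
      rw [← h1]
      refine Finset.sum_congr rfl fun e _ => ?_
      simp only [ridgeJet, q, Pi.smul_apply, smul_eq_mul, mul_pow, Finset.prod_mul_distrib,
        Finset.prod_pow_eq_pow_sum, smul_dotProduct]
      ring
    have hQ : ∀ i, ∀ m ≤ r i, Q i m = 0 := by
      refine hermite_coeff_eq_zero hw hr fun g hg => ?_
      rw [← sum_factorial_mul_taylor_coeff_eq_zero hσ ha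
        (fun e => e.2.2.trans (hle e.1)) hkill hg, Fintype.sum_sigma]
      refine Finset.sum_congr rfl fun i _ => ?_
      rw [← Finset.sum_fiberwise_of_maps_to (s := Finset.univ) (t := Finset.range (r i + 1))
        (g := fun β : MultiIndex d (r i) => ∑ k, β.1 k)
        (fun β _ => Finset.mem_range.2 (Nat.lt_succ_of_le β.2))]
      refine Finset.sum_congr rfl fun m _ => ?_
      rw [Finset.sum_mul]
      refine Finset.sum_congr rfl fun β hβ => ?_
      rw [(Finset.mem_filter.1 hβ).2]
    have hsum : MvPolynomial.eval w (p i) = ∑ β : MultiIndex d (r i), q ⟨i, β⟩ := by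
      simp only [p, q, map_sum, MvPolynomial.eval_monomial]
      refine Finset.sum_congr rfl fun β _ => ?_
      rw [mul_comm, Finsupp.prod_fintype _ _ (by simp)]
      rfl
    rw [hsum, ← Finset.sum_fiberwise_of_maps_to (s := Finset.univ) (t := Finset.range (r i + 1))
        (g := fun β : MultiIndex d (r i) => ∑ k, β.1 k)
        (fun β _ => Finset.mem_range.2 (Nat.lt_succ_of_le β.2))]
    exact Finset.sum_eq_zero fun m hm => hQ i m (Nat.lt_succ_iff.1 (Finset.mem_range.1 hm))
  rintro ⟨i, β⟩
  have h2 := congrArg (MvPolynomial.coeff (Finsupp.equivFunOnFinite.symm β.1)) (hp i)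
  simp only [p, MvPolynomial.coeff_sum, MvPolynomial.coeff_monomial, MvPolynomial.coeff_zero,
    EmbeddingLike.apply_eq_iff_eq, ← Subtype.ext_iff] at h2
  simpa using h2

/-- In a space of dimension at most `n`, some `n` members of a spanning family span. -/
lemma exists_fin_span_eq_top {V α : Type*} [AddCommGroup V] [Module ℝ V] [FiniteDimensional ℝ V]
    [Nonempty α] {f : α → V} (hf : Submodule.span ℝ (range f) = ⊤) {n : ℕ}
    (hn : Module.finrank ℝ V ≤ n) :
    ∃ g : Fin n → α, Submodule.span ℝ (range fun j => f (g j)) = ⊤ := by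
  classical
  obtain ⟨b, hb, hspan, hli⟩ := exists_linearIndependent ℝ (range f)
  have : Finite b := hli.finite
  have := Fintype.ofFinite b
  have hcard : Fintype.card b ≤ Fintype.card (Fin n) := by
    simpa using hli.fintype_card_le_finrank.trans hn
  obtain ⟨e⟩ := Function.Embedding.nonempty_of_card_le hcard
  choose pre hpre using fun x : b => hb x.2
  -- Surplus indices receive an arbitrary member, which cannot shrink the span.
  refine ⟨Function.extend e pre fun _ => Classical.arbitrary α, ?_⟩
  rw [eq_top_iff, ← hf, ← hspan]
  apply Submodule.span_mono
  intro x hx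
  refine ⟨e ⟨x, hx⟩, ?_⟩
  simp only [e.injective.extend_apply, hpre]

/-! ### Differentiating and interpolating with ridge functions -/

section Ridge

variable {d c : ℕ} {ι : Type*} [Fintype ι]

/-- A linear combination of ridge functions with profile `σ⁽ᵐ⁾`, plus a constant. -/
noncomputable def ridge (σ : ℝ → ℝ) (w : ι → Vec d) (b : ι → ℝ) (m : ℕ) (C : Vec c)
    (A : ι → Vec c) (x : Vec d) : Vec c :=
  C + ∑ j, iteratedDeriv m σ (w j ⬝ᵥ x + b j) • A j

lemma contDiff_ridge {m n K : ℕ} (h : n + m ≤ K) {σ : ℝ → ℝ} (hσ : ContDiff ℝ K σ)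
    (w : ι → Vec d) (b : ι → ℝ) (C : Vec c) (A : ι → Vec c) :
    ContDiff ℝ n (ridge σ w b m C A) := by
  have h1 := contDiff_iteratedDeriv h hσ
  refine contDiff_const.add (ContDiff.sum fun j _ => ContDiff.smul (h1.comp ?_) contDiff_const)
  simp only [dotProduct]
  fun_prop

lemma pderiv_ridge {m K : ℕ} (h : m + 1 ≤ K) {σ : ℝ → ℝ} (hσ : ContDiff ℝ K σ)
    (w : ι → Vec d) (b : ι → ℝ) (C : Vec c) (A : ι → Vec c) (i : Fin d) :
    pderiv i (ridge σ w b m C A) = ridge σ w b (m + 1) 0 (fun j => w j i • A j) := by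
  ext1 x
  refine HasLineDerivAt.lineDeriv ?_
  have h1 := (contDiff_iteratedDeriv (m := m) (n := 1) (by omega) hσ).differentiable (by simp)
  have key : ∀ j, HasDerivAt (fun t : ℝ => iteratedDeriv m σ
      (w j ⬝ᵥ (x + t • Pi.single i 1) + b j) • A j)
      (iteratedDeriv (m + 1) σ (w j ⬝ᵥ x + b j) • (w j i • A j)) 0 := by
    intro j
    have h2 : HasDerivAt (fun t : ℝ => w j ⬝ᵥ (x + t • Pi.single i (1 : ℝ)) + b j) (w j i) 0 := by
      simp only [dotProduct_add, dotProduct_smul, dotProduct_single_one, smul_eq_mul]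
      simpa using (((hasDerivAt_id (0 : ℝ)).mul_const (w j i)).const_add (w j ⬝ᵥ x)).add_const (b j)
    have h3 := (h1 (w j ⬝ᵥ (x + (0 : ℝ) • Pi.single i (1 : ℝ)) + b j)).hasDerivAt
    have h4 := (h3.comp (0 : ℝ) h2).smul_const (A j)
    rw [zero_smul, add_zero, ← iteratedDeriv_succ, mul_smul] at h4
    exact h4
  have hsum := (HasDerivAt.fun_sum fun j (_ : j ∈ Finset.univ) => key j).const_add C
  rw [ridge, zero_add]
  exact hsum

/-- The output bias survives only when `n = 0`, hence the unspecified `C'`; the last clause serves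
interpolation, where the bias is zero. -/
lemma iterate_pderiv_ridge {K : ℕ} {σ : ℝ → ℝ} (hσ : ContDiff ℝ K σ)
    (w : ι → Vec d) (b : ι → ℝ) (i : Fin d) (n : ℕ) {m : ℕ} (h : m + n ≤ K)
    (C : Vec c) (A : ι → Vec c) :
    ∃ C' : Vec c, (pderiv i)^[n] (ridge σ w b m C A)
      = ridge σ w b (m + n) C' (fun j => w j i ^ n • A j) ∧ (C = 0 → C' = 0) := by
  induction n with
  | zero => exact ⟨C, by simp, id⟩
  | succ n ih =>
    obtain ⟨C', h1, -⟩ := ih (by omega)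
    refine ⟨0, ?_, fun _ => rfl⟩
    rw [Function.iterate_succ_apply', h1, pderiv_ridge (by omega) hσ]
    simp only [smul_smul, pow_succ', add_assoc]

lemma multiDeriv_ridge {K : ℕ} {σ : ℝ → ℝ} (hσ : ContDiff ℝ K σ) (w : ι → Vec d) (b : ι → ℝ)
    {β : Fin d → ℕ} (h : ∑ k, β k ≤ K) (C : Vec c) (A : ι → Vec c) :
    ∃ C' : Vec c, multiDeriv β (ridge σ w b 0 C A)
      = ridge σ w b (∑ k, β k) C' (fun j => (∏ k, w j k ^ β k) • A j) ∧ (C = 0 → C' = 0) := by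
  have key : ∀ L : List (Fin d), (L.map β).sum ≤ K → ∃ C' : Vec c,
      L.foldr (fun i g => (pderiv i)^[β i] g) (ridge σ w b 0 C A)
        = ridge σ w b (L.map β).sum C' (fun j => (L.map fun k => w j k ^ β k).prod • A j) ∧
        (C = 0 → C' = 0) := by
    intro L
    induction L with
    | nil => exact fun _ => ⟨C, by simp, id⟩
    | cons i L ih =>
      intro hL
      rw [List.map_cons, List.sum_cons] at hL
      obtain ⟨C₁, h1, h1'⟩ := ih (by omega)
      obtain ⟨C₂, h2, h2'⟩ := iterate_pderiv_ridge hσ w b i (β i) (m := (L.map β).sum) (by omega)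
        C₁ (fun j => (L.map fun k => w j k ^ β k).prod • A j)
      refine ⟨C₂, ?_, h2' ∘ h1'⟩
      rw [List.foldr_cons, h1, h2]
      simp only [smul_smul, List.map_cons, List.sum_cons, List.prod_cons, add_comm]
  have hs : ((List.finRange d).map β).sum = ∑ k, β k := by
    rw [← List.ofFn_eq_map, List.sum_ofFn]
  obtain ⟨C', h1, h2⟩ := key (List.finRange d) (hs ▸ h)
  refine ⟨C', ?_, h2⟩
  rw [multiDeriv, h1, hs]
  simp only [← List.ofFn_eq_map, List.prod_ofFn]

lemma continuous_multiDeriv_ridge {K : ℕ} {σ : ℝ → ℝ} (hσ : ContDiff ℝ K σ) (w : ι → Vec d)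
    (b : ι → ℝ) {β : Fin d → ℕ} (h : ∑ k, β k ≤ K) (C : Vec c) (A : ι → Vec c) :
    Continuous (multiDeriv β (ridge σ w b 0 C A)) := by
  obtain ⟨C', h1, -⟩ := multiDeriv_ridge hσ w b h C A
  rw [h1]
  exact (contDiff_ridge (n := 0) (by omega) hσ w b C' _).continuous

/-- Hermite interpolation by ridge functions. -/
lemma exists_ridge_multiDeriv_eq {κ : Type*} [Fintype κ] {K : ℕ} {σ : ℝ → ℝ}
    (hσ : ContDiff ℝ K σ) {a : ℝ} (ha : ∀ k ≤ K, iteratedDeriv k σ a ≠ 0)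
    {z : κ → Vec d} (hz : Function.Injective z) {r : κ → ℕ} (hr : ∑ i, (r i + 1) ≤ K + 1)
    {n : ℕ} (hn : Nat.card (Σ i, MultiIndex d (r i)) ≤ n)
    (y : (Σ i, MultiIndex d (r i)) → Vec c) :
    ∃ (w : Fin n → Vec d) (b : Fin n → ℝ) (A : Fin n → Vec c),
      ∀ e : Σ i, MultiIndex d (r i), multiDeriv e.2.1 (ridge σ w b 0 0 A) (z e.1) = y e := by
  have := Fintype.ofFinite (Σ i, MultiIndex d (r i))
  obtain ⟨g, hg⟩ := exists_fin_span_eq_top (span_ridgeJet hσ ha hz hr) (n := n)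
    (by rwa [Module.finrank_fintype_fun_eq_card, ← Nat.card_eq_fintype_card])
  -- The same hidden units serve all output components; only the outer weights depend on `l`.
  have hmem : ∀ l : Fin c, ∃ A : Fin n → ℝ,
      ∑ j, A j • ridgeJet σ z r (g j).1 (g j).2 = fun e => y e l := fun l =>
    (Submodule.mem_span_range_iff_exists_fun ℝ).1 (hg ▸ Submodule.mem_top)
  choose A hA using hmem
  refine ⟨fun j => (g j).1, fun j => (g j).2, fun j l => A l j, fun e => ?_⟩
  have hle : ∑ k, e.2.1 k ≤ K := by
    have h1 := Finset.single_le_sum (f := fun i => r i + 1) (fun _ _ => Nat.zero_le _)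
      (Finset.mem_univ e.1)
    have h2 := e.2.2
    omega
  obtain ⟨C', h1, h2⟩ := multiDeriv_ridge hσ (fun j => (g j).1) (fun j => (g j).2) hle
    (0 : Vec c) (fun j l => A l j)
  rw [h1, h2 rfl]
  ext l
  rw [← congrFun (hA l) e]
  simp only [ridge, zero_add, Finset.sum_apply, Pi.smul_apply, smul_eq_mul, ridgeJet]
  exact Finset.sum_congr rfl fun j _ => by ring

end Ridge

/-! ### Networks as fields on the closed domain -/

section Fields

variable {d c : ℕ} {Ω : Set (Vec d)}

lemma ext_apply (u : Fld Ω c) {x : Vec d} (hx : x ∈ closure Ω) : ext u x = u ⟨x, hx⟩ :=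
  dif_pos hx

lemma multiDeriv_zero (f : Vec d → Vec c) : multiDeriv 0 f = f := by
  unfold multiDeriv
  induction List.finRange d with
  | nil => rfl
  | cons i L _ => simp

lemma pderiv_eqOn (hΩ : IsOpen Ω) {f g : Vec d → Vec c} (h : EqOn f g Ω) (i : Fin d) :
    EqOn (pderiv i f) (pderiv i g) Ω := fun _ hx =>
  (h.eventuallyEq_of_mem (hΩ.mem_nhds hx)).lineDeriv_eq

lemma multiDeriv_eqOn (hΩ : IsOpen Ω) {f g : Vec d → Vec c} (h : EqOn f g Ω) (β : Fin d → ℕ) :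
    EqOn (multiDeriv β f) (multiDeriv β g) Ω := by
  unfold multiDeriv
  induction List.finRange d with
  | nil => exact h
  | cons i L ih =>
    simp only [List.foldr_cons]
    induction β i with
    | zero => exact ih
    | succ n ih' =>
      simp only [Function.iterate_succ_apply']
      exact pderiv_eqOn hΩ ih' i

lemma tendsto_ext {u : Fld Ω c} (hu : Continuous u) {z : Vec d} (hz : z ∈ closure Ω) :
    Tendsto (ext u) (𝓝[Ω] z) (𝓝 (ext u z)) := by
  have h : ContinuousOn (ext u) (closure Ω) := by
    rw [continuousOn_iff_continuous_domRestrict]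
    exact hu.congr fun x => (ext_apply u x.2).symm
  exact (h z hz).mono_left (nhdsWithin_mono z subset_closure)

lemma interiorJet_zero (r : ℕ) (u : Fld Ω c) (z : Vec d) :
    interiorJet r u z ⟨0, by simp⟩ = ext u z := by
  simp only [interiorJet, multiDeriv_zero]

/-- Continuity up to the boundary identifies the limit from `Ω` with the value, so that the jets
control the observation term. -/
lemma boundaryJet_zero (r : ℕ) {u : Fld Ω c} (hu : Continuous u) {z : Vec d}
    (hz : z ∈ closure Ω) : boundaryJet r u z ⟨0, by simp⟩ = ext u z := by
  have := mem_closure_iff_nhdsWithin_neBot.1 hz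
  simp only [boundaryJet, multiDeriv_zero]
  exact (tendsto_ext hu hz).limUnder_eq

lemma interiorJet_eq (hΩ : IsOpen Ω) {u : Fld Ω c} {f : Vec d → Vec c} (h : ∀ x, u x = f x)
    (r : ℕ) {z : Vec d} (hz : z ∈ Ω) (β : MultiIndex d r) :
    interiorJet r u z β = multiDeriv β.1 f z :=
  multiDeriv_eqOn hΩ (fun x hx => by rw [ext_apply u (subset_closure hx), h]) β.1 hz

lemma boundaryJet_eq (hΩ : IsOpen Ω) {u : Fld Ω c} {f : Vec d → Vec c} (h : ∀ x, u x = f x)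
    {r : ℕ} {z : Vec d} (hz : z ∈ closure Ω) (β : MultiIndex d r)
    (hf : Continuous (multiDeriv β.1 f)) : boundaryJet r u z β = multiDeriv β.1 f z := by
  have := mem_closure_iff_nhdsWithin_neBot.1 hz
  refine Tendsto.limUnder_eq ((hf.tendsto z).mono_left nhdsWithin_le_nhds |>.congr' ?_)
  filter_upwards [self_mem_nhdsWithin] with x hx
  exact (multiDeriv_eqOn hΩ (fun x hx => by rw [ext_apply u (subset_closure hx), h]) β.1 hx).symm

lemma mem_netClass_iff {n : ℕ} {σ : ℝ → ℝ} {u : Fld Ω c} :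
    u ∈ netClass Ω c n σ ↔ ∃ (w : Fin n → Vec d) (b : Fin n → ℝ) (C : Vec c) (A : Fin n → Vec c),
      ∀ x, u x = ridge σ w b 0 C A x := by
  have key : ∀ (w : Fin n → Vec d) (b : Fin n → ℝ) (C : Vec c) (A : Fin n → Vec c) (x : Vec d),
      (⟨w, b, fun l j => A j l, C⟩ : ShallowNet d n c).eval σ x = ridge σ w b 0 C A x := by
    intro w b C A x
    ext l
    simp [ShallowNet.eval, ridge, Matrix.mulVec, dotProduct, mul_comm, add_comm]
  constructor
  · rintro ⟨θ, hθ⟩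
    exact ⟨θ.W₁, θ.b₁, θ.b₂, fun j l => θ.W₂ l j, fun x => (hθ x).trans (key _ _ _ _ _)⟩
  · rintro ⟨w, b, C, A, h⟩
    exact ⟨_, fun x => (h x).trans (key w b C A x).symm⟩

lemma netClass_subset_strongSpace (hΩ : IsOpen Ω) {K rF rB n : ℕ} (hF : rF ≤ K) (hB : rB ≤ K)
    {σ : ℝ → ℝ} (hσ : ContDiff ℝ K σ) : netClass Ω c n σ ⊆ strongSpace Ω c rF rB := by
  intro u hu
  obtain ⟨w, b, C, A, h⟩ := mem_netClass_iff.1 hu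
  have heq : EqOn (ext u) (ridge σ w b 0 C A) Ω := fun x hx => by
    rw [ext_apply u (subset_closure hx), h]
  have hcd : ∀ r ≤ K, ContDiffOn ℝ r (ext u) Ω := fun r hr =>
    (contDiff_ridge hr hσ w b C A).contDiffOn.congr heq
  refine ⟨hcd rF hF, ?_, hcd rB hB, fun β => ?_⟩
  · exact ((contDiff_ridge (n := 0) (by omega) hσ w b C A).continuous.comp
      continuous_subtype_val).congr fun x => (h x).symm
  · exact ⟨fun x => multiDeriv β.1 (ridge σ w b 0 C A) x,
      (continuous_multiDeriv_ridge hσ w b (β.2.trans hB) C A).comp continuous_subtype_val,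
      fun z hz => (multiDeriv_eqOn hΩ heq β.1 hz).symm⟩

variable {Γ : Set (Vec d)} {cF cB rF rB : ℕ}

/-- Since `N(d + r) = N(r + 1) + N(d - 1)`, a single collocation point already leaves the required
slack `d - 1`. This is why smoothness of order `ℓ - d` suffices. -/
lemma Problem.sum_order_le (hd : 1 ≤ d) (P : Problem Ω Γ c cF cB rF rB) (hΩh : P.Ωh.Nonempty)
    (hΓh : P.Γh.Nonempty) : P.Ωh.card * (rF + 1) + P.Γh.card * (rB + 1) ≤
      P.Ωh.card * (d + rF) + P.Γh.card * (d + rB) - d + 1 := by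
  obtain ⟨e, rfl⟩ := Nat.exists_eq_add_of_le hd
  have h1 : ∀ N r : ℕ, N * (1 + e + r) = N * (r + 1) + N * e := fun N r => by ring
  have h2 := Nat.le_mul_of_pos_left e (Finset.card_pos.2 hΩh)
  rw [h1, h1]
  omega

/-- Every function has the same jets at the collocation points as some network. -/
lemma exists_net_jet_eq (hd : 1 ≤ d) (hc : 1 ≤ c) (hΩ : IsOpen Ω) (hΓ : Γ ⊆ frontier Ω)
    (P : Problem Ω Γ c cF cB rF rB) (hΩh : P.Ωh.Nonempty) (hΓh : P.Γh.Nonempty)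
    {ℓ : ℕ} (hℓ : ℓ = P.Ωh.card * (d + rF) + P.Γh.card * (d + rB))
    {σ : ℝ → ℝ} (hσ : ContDiff ℝ ((ℓ - d : ℕ) : WithTop ℕ∞) σ) {a : ℝ}
    (ha : ∀ k ≤ ℓ - d, iteratedDeriv k σ a ≠ 0) (u : Fld Ω c) :
    ∃ v ∈ netClass Ω c (c * ℓ.choose d) σ,
      (∀ z ∈ P.Ωh, interiorJet rF v z = interiorJet rF u z) ∧
      ∀ z ∈ P.Γh, boundaryJet rB v z = boundaryJet rB u z := by
  let z : P.Ωh ⊕ P.Γh → Vec d := Sum.elim (fun x => x.1) (fun x => x.1)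
  let r : P.Ωh ⊕ P.Γh → ℕ := Sum.elim (fun _ => rF) (fun _ => rB)
  have hcl : ∀ x ∈ P.Γh, x ∈ closure Ω := fun x hx => frontier_subset_closure (hΓ (P.Γh_sub hx))
  have hz : Function.Injective z := by
    -- Interior and boundary points are distinct because an open set misses its frontier.
    refine Subtype.val_injective.sumElim Subtype.val_injective fun x y hxy => ?_
    have h1 : x.1 ∈ frontier Ω := hxy ▸ hΓ (P.Γh_sub y.2)
    rw [hΩ.frontier_eq] at h1
    exact h1.2 (P.Ωh_sub x.2)
  have hr : ∑ i, (r i + 1) ≤ ℓ - d + 1 := by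
    simpa [r, hℓ] using P.sum_order_le hd hΩh hΓh
  have hn : Nat.card (Σ i, MultiIndex d (r i)) ≤ c * ℓ.choose d := by
    have h1 : Nat.card (Σ i, MultiIndex d (r i)) ≤ ∑ i, (d + r i).choose d := by
      rw [Nat.card_sigma]
      exact Finset.sum_le_sum fun i _ => card_multiIndex_le d (r i)
    have h2 : ∑ i, (d + r i).choose d
        = P.Ωh.card * (d + rF).choose d + P.Γh.card * (d + rB).choose d := by simp [r]
    calc _ ≤ P.Ωh.card * (d + rF).choose d + P.Γh.card * (d + rB).choose d := h1.trans_eq h2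
      _ ≤ (P.Ωh.card * (d + rF)).choose d + (P.Γh.card * (d + rB)).choose d :=
        add_le_add (mul_choose_le hd _ _) (mul_choose_le hd _ _)
      _ ≤ ℓ.choose d := hℓ ▸ choose_add_choose_le hd _ _
      _ ≤ _ := Nat.le_mul_of_pos_left _ hc
  have hle : ∀ i, r i ≤ ℓ - d := fun i => by
    have := Finset.single_le_sum (f := fun i => r i + 1) (fun _ _ => Nat.zero_le _)
      (Finset.mem_univ i)
    omega
  -- The targets are mere numbers, so no regularity of `u` is needed.
  let y : (Σ i, MultiIndex d (r i)) → Vec c := fun e => match e with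
    | ⟨.inl x, β⟩ => interiorJet rF u x β
    | ⟨.inr x, β⟩ => boundaryJet rB u x β
  obtain ⟨w, b, A, h⟩ := exists_ridge_multiDeriv_eq hσ ha hz hr hn y
  refine ⟨fun x => ridge σ w b 0 0 A x, mem_netClass_iff.2 ⟨w, b, 0, A, fun _ => rfl⟩,
    fun x hx => funext fun β => ?_, fun x hx => funext fun β => ?_⟩
  · rw [interiorJet_eq hΩ (fun _ => rfl) rF (P.Ωh_sub hx)]
    exact h ⟨.inl ⟨x, hx⟩, β⟩
  · rw [boundaryJet_eq hΩ (fun _ => rfl) (hcl x hx) β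
      (continuous_multiDeriv_ridge hσ w b (β.2.trans (hle (.inr ⟨x, hx⟩))) 0 A)]
    exact h ⟨.inr ⟨x, hx⟩, β⟩

end Fields

end PINN

/-! ### Comparison of the two minimization problems -/

theorem mainTheorem1 {d c cF cB rF rB : ℕ} (hd : 1 ≤ d) (hc : 1 ≤ c)
    {Ω Γ : Set (PINN.Vec d)} (hΩ : IsOpen Ω) (hΓ : Γ ⊆ frontier Ω)
    (P : PINN.Problem Ω Γ c cF cB rF rB)
    (hΩh : P.Ωh.Nonempty) (hΓh : P.Γh.Nonempty)
    (ℓ : ℕ) (hℓ : ℓ = P.Ωh.card * (d + rF) + P.Γh.card * (d + rB))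
    (σ : ℝ → ℝ) (hσ : ContDiff ℝ ((ℓ - d : ℕ) : WithTop ℕ∞) σ)
    (hσa : ∃ a : ℝ, ∀ k ≤ ℓ - d, iteratedDeriv k σ a ≠ 0)
    (H : Set (PINN.Fld Ω c)) (hH : H = PINN.netClass Ω c (c * ℓ.choose d) σ)
    (U : Set (PINN.Fld Ω c)) (hU : U ⊆ PINN.strongSpace Ω c rF rB)
    (hHU : H ∩ PINN.strongSpace Ω c rF rB ⊆ U) :
    (∀ u : PINN.Fld Ω c, PINN.IsMinimizer P.loss U u →
      ∃ v : PINN.Fld Ω c, PINN.IsMinimizer P.loss H v ∧ P.loss v = P.loss u ∧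
        ∀ z : closure Ω, ((z : PINN.Vec d) ∈ P.Ωh ∨ (z : PINN.Vec d) ∈ P.Γh) → v z = u z) ∧
    (∀ v : PINN.Fld Ω c, PINN.IsMinimizer P.loss H v → PINN.IsMinimizer P.loss U v) := by
  obtain ⟨a, ha⟩ := hσa
  have horder := P.sum_order_le hd hΩh hΓh
  rw [← hℓ] at horder
  have hN := Nat.le_mul_of_pos_left (rF + 1) (Finset.card_pos.2 hΩh)
  have hM := Nat.le_mul_of_pos_left (rB + 1) (Finset.card_pos.2 hΓh)
  have hHX : H ⊆ PINN.strongSpace Ω c rF rB :=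
    hH ▸ PINN.netClass_subset_strongSpace hΩ (by omega) (by omega) hσ
  have hHsub : H ⊆ U := fun v hv => hHU ⟨hv, hHX hv⟩
  have hcl : ∀ z ∈ P.Γh, z ∈ closure Ω := fun z hz =>
    frontier_subset_closure (hΓ (P.Γh_sub hz))
  -- Every value of the loss on `U` is attained on `H`, by a network that also agrees with `u` at
  -- the collocation points.
  have key : ∀ u ∈ U, ∃ v ∈ H, P.loss v = P.loss u ∧
      ∀ z, (z ∈ P.Ωh ∨ z ∈ P.Γh) → PINN.ext v z = PINN.ext u z := by
    intro u hu
    obtain ⟨v, hv, hF, hB⟩ := PINN.exists_net_jet_eq hd hc hΩ hΓ P hΩh hΓh hℓ hσ ha u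
    rw [← hH] at hv
    have hval : ∀ z, (z ∈ P.Ωh ∨ z ∈ P.Γh) → PINN.ext v z = PINN.ext u z := by
      rintro z (hz | hz)
      · rw [← PINN.interiorJet_zero rF, hF z hz, PINN.interiorJet_zero]
      · rw [← PINN.boundaryJet_zero rB (hHX hv).2.1 (hcl z hz), hB z hz,
          PINN.boundaryJet_zero rB (hU hu).2.1 (hcl z hz)]
    refine ⟨v, hv, ?_, hval⟩
    unfold PINN.Problem.loss
    congr 2
    · congr 1
      exact Finset.sum_congr rfl fun z hz => by rw [hF z hz]
    · congr 1
      exact Finset.sum_congr rfl fun z hz => by rw [hB z hz]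
    · exact Finset.sum_congr rfl fun z hz => by rw [hval z (P.Dh_sub hz)]
  constructor
  · rintro u ⟨hu, hmin⟩
    obtain ⟨v, hv, hloss, hval⟩ := key u hu
    refine ⟨v, ⟨hv, fun w hw => ?_⟩, hloss, fun z hz => ?_⟩
    · exact hloss.trans_le (hmin (hHsub hw))
    · simpa only [PINN.ext_apply _ z.2] using hval z hz
  · rintro v ⟨hv, hmin⟩
    refine ⟨hHsub hv, fun w hw => ?_⟩
    obtain ⟨v', hv', hloss, -⟩ := key w hw
    exact (hmin hv').trans_eq hloss
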